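/- Let $A$ be an integrally closed domain with quotient field $K$, let $a,b\in A$ be nonzero elements, and let $B=A[a/b]\subseteq K$. Let $(bA:_A a)=\{x\in A : xa\in bA\}$, let $J=(bA:_A a)B$ be the ideal of $B$ generated by it, and let $J^{-1}=\{x\in K : xJ\subseteq B\}$, a $B$-submodule of $K$ containing $B$. If $a^2A\cap b^2A=(aA\cap bA)^2$, then the first André–Quillen cohomology module of the $A$-algebra $B$ with coefficients in $B$ satisfies $$H^1(A,B,B)\cong J^{-1}/B=\bigl((bA:_A a)B\bigr)^{-1}/B$$ as $B$-modules. Here $H^n(A,B,W)$, for a $B$-module $W$, is the $n$-th cohomology of the cochain complex $\mathrm{Der}_A(P_\bullet,W)$, where $P_\bullet\to B$ is the standard simplicial resolution of the $A$-algebra $B$ by polynomial $A$-algebras ($P_0=A[B]$, $P_{n+1}=A[P_n]$, where $A[S]$ is the polynomial algebra over $A$ with one variable for each element of the set $S$). -/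

import Mathlib

/-! André–Quillen cohomology, computed from the standard (cotriple) simplicial resolution of an
algebra by polynomial algebras, and the inverse of an ideal of a domain. -/

universe u v w

namespace AndreQuillen

section Resolution

variable (A : Type u) [CommRing A] (B : Type v) [CommRing B] [Algebra A B]

/-- The standard resolution of the `A`-algebra `B` by polynomial algebras: `A[B]` in degree `0`,
and in degree `n + 1` the polynomial algebra over `A` with one variable for every element of the
algebra in degree `n`. -/
noncomputable def stdRes : ℕ → CommAlgCat.{max u v} A
  | 0 => CommAlgCat.of A (MvPolynomial B A)
  | n + 1 => CommAlgCat.of A (MvPolynomial (stdRes n) A)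

/-- The counit `A[C] → C`, which sends the variable of index `c` to `c`. -/
noncomputable def counit (C : Type w) [CommRing C] [Algebra A C] : MvPolynomial C A →ₐ[A] C :=
  MvPolynomial.aeval id

/-- The face operators `d_i`, `0 ≤ i ≤ n + 1`, from degree `n + 1` to degree `n`. With
`F = A[-]` and `ε` the counit, `d_i = F^i ε F^(n+1-i)`. -/
noncomputable def face : (n : ℕ) → Fin (n + 2) → (stdRes A B (n + 1) →ₐ[A] stdRes A B n)
  | 0 => Fin.cons (counit A (stdRes A B 0)) fun _ => MvPolynomial.rename (counit A B)
  | n + 1 => Fin.cons (counit A (stdRes A B (n + 1))) fun i => MvPolynomial.rename (face n i)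

/-- The augmentation of the standard resolution. -/
noncomputable def aug : (n : ℕ) → (stdRes A B n →ₐ[A] B)
  | 0 => counit A B
  | n + 1 => (aug n).comp (counit A (stdRes A B n))

variable {A B}

theorem comp_counit {C : Type*} {D : Type*} [CommRing C] [Algebra A C] [CommRing D]
    [Algebra A D] (f : C →ₐ[A] D) :
    (counit A D).comp (MvPolynomial.rename f) = f.comp (counit A C) := by
  apply MvPolynomial.algHom_ext
  intro c
  simp [counit]

theorem aug_comp_face (n : ℕ) (i : Fin (n + 2)) :
    (aug A B n).comp (face A B n i) = aug A B (n + 1) := by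
  induction n with
  | zero =>
    refine Fin.cases rfl (fun j => ?_) i
    exact comp_counit (counit A B)
  | succ n ih =>
    refine Fin.cases rfl (fun j => ?_) i
    have h1 : (aug A B (n + 1)).comp (face A B (n + 1) j.succ) =
        (aug A B n).comp ((face A B n j).comp (counit A (stdRes A B (n + 1)))) :=
      congrArg (aug A B n).comp (comp_counit (face A B n j))
    exact h1.trans (congrArg (fun f => f.comp (counit A (stdRes A B (n + 1)))) (ih j))

end Resolution

section Cohomology

variable (A : Type u) [CommRing A] (B : Type v) [CommRing B] [Algebra A B]
  (W : Type w) [AddCommGroup W] [Module B W]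

/-- A `B`-module is a module over every term of the resolution through the augmentation. -/
noncomputable instance stdResModule (n : ℕ) : Module (stdRes A B n) W :=
  Module.compHom W (aug A B n).toRingHom

theorem stdRes_smul_def (n : ℕ) (p : stdRes A B n) (x : W) : p • x = aug A B n p • x := rfl

instance stdRes_smulCommClass (n : ℕ) : SMulCommClass B (stdRes A B n) W :=
  ⟨fun b p x => smul_comm b (aug A B n p) x⟩

variable [Module A W] [IsScalarTower A B W]

/-- The cochains of degree `n`: the `A`-derivations from the degree `n` term of the resolution
to `W`. -/
abbrev Cochain (n : ℕ) : Type _ := Derivation A (stdRes A B n) W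

/-- Composition of derivations with the face operator `d_i`. -/
noncomputable def coface (n : ℕ) (i : Fin (n + 2)) :
    Cochain A B W n →ₗ[B] Cochain A B W (n + 1) where
  toFun D := Derivation.mk' (D.toLinearMap.comp (face A B n i).toLinearMap) fun p q => by
    have h (r : stdRes A B (n + 1)) (x : W) : face A B n i r • x = r • x := by
      rw [stdRes_smul_def, stdRes_smul_def, ← aug_comp_face n i]; rfl
    simp [h]
  map_add' _ _ := rfl
  map_smul' _ _ := rfl

/-- The differential `δ = ∑ (-1)^i (- ∘ d_i)` of the cochain complex `Der_A(P_•, W)`. -/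
noncomputable def delta (n : ℕ) : Cochain A B W n →ₗ[B] Cochain A B W (n + 1) :=
  ∑ i : Fin (n + 2), (-1 : ℤ) ^ (i : ℕ) • coface A B W n i

/-- The cocycles of degree `n`. -/
noncomputable def cocycles (n : ℕ) : Submodule B (Cochain A B W n) :=
  LinearMap.ker (delta A B W n)

/-- The coboundaries of degree `n`. -/
noncomputable def coboundaries : (n : ℕ) → Submodule B (Cochain A B W n)
  | 0 => ⊥
  | n + 1 => LinearMap.range (delta A B W n)

/-- The André–Quillen cohomology module `Hⁿ(A, B, W)`: cocycles modulo coboundaries. -/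
abbrev H (n : ℕ) : Type _ :=
  cocycles A B W n ⧸ (coboundaries A B W n).submoduleOf (cocycles A B W n)

end Cohomology

end AndreQuillen

section Inverse

variable {B : Type u} [CommRing B] (K : Type v) [Field K] [Algebra B K]

/-- The inverse `J⁻¹ = {x ∈ K | x J ⊆ B}` of an ideal `J` of a domain `B` with quotient
field `K`. -/
def idealInverse (J : Ideal B) : Submodule B K where
  carrier := {x | ∀ y ∈ J, x * algebraMap B K y ∈ (1 : Submodule B K)}
  add_mem' hx hx' y hy := by
    rw [add_mul]
    exact add_mem (hx y hy) (hx' y hy)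
  zero_mem' y _ := by simp
  smul_mem' c x hx y hy := by
    rw [smul_mul_assoc]
    exact Submodule.smul_mem _ c (hx y hy)

/-- The `B`-module `J⁻¹ / B`. -/
abbrev InverseQuotient (J : Ideal B) : Type _ :=
  idealInverse K J ⧸ (1 : Submodule B K).submoduleOf (idealInverse K J)

end Inverse

/-! Write `I` for the kernel of `A[B] → B` and `ξ = a / b`. A 1-cocycle is determined by an
`A[B]`-linear form on `I` (`cocycleForm`, `formCochain`), and it is a coboundary exactly when this
form extends to a derivation of `A[B]`. So `H¹` is the cokernel of `Der(A[B], B) → Hom(I, B)`. The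
variable of `ξ` already generates `B`, so `A[B]` can be compared with `A[X]`. As `A` is integrally
closed, the polynomials vanishing at `ξ` are generated by the `lX - d` with `la = db`, and `b(lX -
d) = l(bX - a)`. Hence a form `φ` satisfies `φ(r) = y r'(ξ)` there, with `y = φ(bX - a) / b`. The
values `r'(ξ)` lie in `J` and include every such `l`, so the possible `y` are the elements of `J⁻¹`.
Coboundaries correspond to `y ∈ B`. -/

namespace AndreQuillen

/-! ### 1-cocycles as linear forms on the augmentation ideal -/

section FirstCohomology

variable {A : Type u} [CommRing A] {B : Type v} [CommRing B] [Algebra A B]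

variable (A B) in
/-- The variable of `A[B]` indexed by an element of `B`. -/
noncomputable def gen (c : B) : stdRes A B 0 :=
  (MvPolynomial.X c : MvPolynomial B A)

/-- The variable of the term of degree `n + 1` indexed by an element of the term of degree `n`. -/
noncomputable def bar {n : ℕ} (p : stdRes A B n) : stdRes A B (n + 1) :=
  (MvPolynomial.X p : MvPolynomial (stdRes A B n) A)

@[simp]
theorem aug_gen (c : B) : aug A B 0 (gen A B c) = c :=
  MvPolynomial.aeval_X _ _

@[simp]
theorem face_zero_bar {n : ℕ} (p : stdRes A B n) : face A B n 0 (bar p) = p := by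
  cases n <;> exact MvPolynomial.aeval_X _ _

@[simp]
theorem face_one_bar (p : stdRes A B 0) : face A B 0 1 (bar p) = gen A B (aug A B 0 p) :=
  MvPolynomial.rename_X _ _

theorem face_succ_bar {n : ℕ} (i : Fin (n + 2)) (p : stdRes A B (n + 1)) :
    face A B (n + 1) i.succ (bar p) = bar (face A B n i p) :=
  MvPolynomial.rename_X _ _

theorem aug_face (n : ℕ) (i : Fin (n + 2)) (p : stdRes A B (n + 1)) :
    aug A B n (face A B n i p) = aug A B (n + 1) p :=
  DFunLike.congr_fun (aug_comp_face n i) p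

theorem face_zero_face_succ (n : ℕ) (i : Fin (n + 2)) (p : stdRes A B (n + 2)) :
    face A B n 0 (face A B (n + 1) i.succ p) = face A B n i (face A B (n + 1) 0 p) := by
  have h := DFunLike.congr_fun (comp_counit (face A B n i)) p
  cases n <;> exact h

theorem face_one_face_one (p : stdRes A B 2) :
    face A B 0 1 (face A B 1 1 p) = face A B 0 1 (face A B 1 2 p) := by
  have h : (face A B 0 1).comp (face A B 1 1) = (face A B 0 1).comp (face A B 1 2) := by
    refine MvPolynomial.algHom_ext fun q => ?_
    change face A B 0 1 (face A B 1 (Fin.succ 0) (bar q)) =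
      face A B 0 1 (face A B 1 (Fin.succ 1) (bar q))
    rw [face_succ_bar, face_succ_bar, face_one_bar, face_one_bar, aug_face, aug_face]
  exact DFunLike.congr_fun h p

variable {W : Type w} [AddCommGroup W] [Module B W] [Module A W] [IsScalarTower A B W]

theorem delta_zero_apply (g : Cochain A B W 0) (q : stdRes A B 1) :
    delta A B W 0 g q = g (face A B 0 0 q) - g (face A B 0 1 q) := by
  simp [delta, Fin.sum_univ_two, sub_eq_add_neg]
  rfl

theorem delta_one_apply (D : Cochain A B W 1) (q : stdRes A B 2) :
    delta A B W 1 D q = D (face A B 1 0 q) - D (face A B 1 1 q) + D (face A B 1 2 q) := by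
  simp [delta, Fin.sum_univ_three, sub_eq_add_neg]
  rfl

/-- This is `δD = 0` at the variable `bar q`: `d₀` removes the bar, while `d₁` and `d₂` act under
it. A cocycle is thus determined by its values on variables. -/
theorem cocycle_apply {D : Cochain A B W 1} (hD : D ∈ cocycles A B W 1) (q : stdRes A B 1) :
    D q = D (bar (face A B 0 0 q)) - D (bar (face A B 0 1 q)) := by
  have h : delta A B W 1 D (bar q) = 0 := by
    rw [show delta A B W 1 D = 0 from hD]; rfl
  rw [delta_one_apply, face_zero_bar] at h
  have h1 : face A B 1 1 (bar q) = bar (face A B 0 0 q) := face_succ_bar 0 q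
  have h2 : face A B 1 2 (bar q) = bar (face A B 0 1 q) := face_succ_bar 1 q
  rw [h1, h2] at h
  rw [← sub_eq_zero, ← h]
  abel

theorem cocycle_bar_gen {D : Cochain A B W 1} (hD : D ∈ cocycles A B W 1) (c : B) :
    D (bar (gen A B c)) = 0 := by
  have h := cocycle_apply hD (bar (gen A B c))
  rw [face_zero_bar, face_one_bar, aug_gen, sub_self] at h
  exact h

/-- The linear form on the augmentation ideal of `A[B]` determined by a `1`-cocycle. -/
noncomputable def cocycleForm (D : Cochain A B W 1) (p : stdRes A B 0) : W :=
  D (bar p) - D (bar 0)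

/-- The elements `bar p + bar q` and `bar 0 + bar 0` have the same image under `d₁`, so those terms
cancel when the cocycle identities are subtracted. The next two lemmas use the same comparison. -/
theorem cocycleForm_add {D : Cochain A B W 1} (hD : D ∈ cocycles A B W 1)
    {p q : stdRes A B 0} (hp : aug A B 0 p = 0) (hq : aug A B 0 q = 0) :
    cocycleForm D (p + q) = cocycleForm D p + cocycleForm D q := by
  have h1 := cocycle_apply hD (bar p + bar q)
  have h2 := cocycle_apply hD (bar 0 + bar 0)
  simp only [map_add, face_zero_bar, face_one_bar, hp, hq, map_zero, add_zero] at h1 h2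
  simp only [cocycleForm]
  linear_combination (norm := module) h2 - h1

theorem cocycleForm_mul {D : Cochain A B W 1} (hD : D ∈ cocycles A B W 1)
    (r : stdRes A B 0) {p : stdRes A B 0} (hp : aug A B 0 p = 0) :
    cocycleForm D (r * p) = aug A B 0 r • cocycleForm D p := by
  have h1 := cocycle_apply hD (bar r * bar p)
  have h2 := cocycle_apply hD (bar r * bar 0)
  simp only [Derivation.leibniz, stdRes_smul_def, map_mul, ← aug_face 0 0, face_zero_bar,
    face_one_bar, hp, map_zero, mul_zero, zero_smul, add_zero] at h1 h2
  simp only [cocycleForm]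
  linear_combination (norm := module) h2 - h1

theorem cocycleForm_gen_add {D : Cochain A B W 1} (hD : D ∈ cocycles A B W 1)
    {p : stdRes A B 0} (hp : aug A B 0 p = 0) (c : B) :
    D (bar (p + gen A B c)) = cocycleForm D p := by
  have h1 := cocycle_apply hD (bar p + bar (gen A B c))
  have h2 := cocycle_apply hD (bar 0 + bar (gen A B c))
  simp only [map_add, face_zero_bar, face_one_bar, hp, aug_gen, map_zero, zero_add,
    cocycle_bar_gen hD, add_zero, zero_sub] at h1 h2
  simp only [cocycleForm]
  linear_combination (norm := module) h2 - h1

theorem aug_face_sub_face (q : stdRes A B 1) :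
    aug A B 0 (face A B 0 0 q - face A B 0 1 q) = 0 := by
  rw [map_sub, aug_face, aug_face, sub_self]

/-- Subtracting from `p` the variable of its augmentation moves it into `I`. Both faces of `q` have
the same augmentation, so the two corrections cancel. -/
theorem cocycle_eq_cocycleForm {D : Cochain A B W 1} (hD : D ∈ cocycles A B W 1)
    (q : stdRes A B 1) : D q = cocycleForm D (face A B 0 0 q - face A B 0 1 q) := by
  have key (p : stdRes A B 0) :
      D (bar p) = cocycleForm D (p - gen A B (aug A B 0 p)) := by
    rw [← cocycleForm_gen_add hD (by rw [map_sub, aug_gen, sub_self]) (aug A B 0 p),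
      sub_add_cancel]
  have h := cocycleForm_add hD (aug_face_sub_face q)
    (q := face A B 0 1 q - gen A B (aug A B 0 (face A B 0 1 q)))
    (by rw [map_sub, aug_gen, sub_self])
  rw [sub_add_sub_cancel] at h
  rw [cocycle_apply hD, key, key, sub_eq_iff_eq_add, ← h, aug_face, aug_face]

/-- A `1`-cocycle is the coboundary of every derivation which restricts to its linear form. -/
theorem delta_eq_of_cocycleForm {D : Cochain A B W 1} (hD : D ∈ cocycles A B W 1)
    (g : Cochain A B W 0) (hg : ∀ p, aug A B 0 p = 0 → g p = cocycleForm D p) :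
    delta A B W 0 g = D := by
  refine Derivation.ext fun q => ?_
  rw [delta_zero_apply, cocycle_eq_cocycleForm hD, ← hg _ (aug_face_sub_face q), map_sub]

theorem cocycleForm_delta (g : Cochain A B W 0) {p : stdRes A B 0} (hp : aug A B 0 p = 0) :
    cocycleForm (delta A B W 0 g) p = g p := by
  simp [cocycleForm, delta_zero_apply, hp]

variable (A B W) in
theorem stdRes_isScalarTower (n : ℕ) : IsScalarTower A (stdRes A B n) W :=
  ⟨fun a p x => by rw [stdRes_smul_def, stdRes_smul_def, map_smul, smul_assoc]⟩

variable (A B) in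
/-- The augmentation ideal of `A[B]`. -/
noncomputable abbrev augIdeal : Ideal (stdRes A B 0) := RingHom.ker (aug A B 0)

/-- The linear form of a `1`-cocycle, as a linear map on the augmentation ideal. -/
noncomputable def cocycleLinearForm {D : Cochain A B W 1} (hD : D ∈ cocycles A B W 1) :
    augIdeal A B →ₗ[stdRes A B 0] W where
  toFun p := cocycleForm D p
  map_add' p q := cocycleForm_add hD p.2 q.2
  map_smul' r p := cocycleForm_mul hD r p.2

/-- The derivation `p ↦ φ (f p - g p)` for a linear form `φ` on the augmentation ideal and two
algebra homomorphisms `f`, `g` to `A[B]` over `B`. -/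
noncomputable def diffCochain {n : ℕ} (φ : augIdeal A B →ₗ[stdRes A B 0] W)
    (f g : stdRes A B n →ₐ[A] stdRes A B 0) (hf : ∀ p, aug A B 0 (f p) = aug A B n p)
    (hg : ∀ p, aug A B 0 (g p) = aug A B n p) : Cochain A B W n :=
  haveI := stdRes_isScalarTower A B W 0
  let δ : stdRes A B n →ₗ[A] augIdeal A B :=
    (f.toLinearMap - g.toLinearMap).codRestrict ((augIdeal A B).restrictScalars A) fun p =>
      show aug A B 0 (f p - g p) = 0 by rw [map_sub, hf, hg, sub_self]
  Derivation.mk' (φ.restrictScalars A ∘ₗ δ) fun p q => by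
    -- A difference of homomorphisms obeys a twisted Leibniz rule; the twist is invisible on `W`
    -- because `f` and `g` agree after augmentation.
    have h : δ (p * q) = f p • δ q + g q • δ p := by
      refine Subtype.ext ?_
      change f (p * q) - g (p * q) = f p * (f q - g q) + g q * (f p - g p)
      rw [map_mul, map_mul]
      ring
    rw [LinearMap.comp_apply, h, map_add]
    simp only [LinearMap.restrictScalars_apply, map_smul, LinearMap.comp_apply, stdRes_smul_def,
      hf, hg]

/-- The cochain `q ↦ φ (d₀ q - d₁ q)` of a linear form `φ` on the augmentation ideal. -/
noncomputable def formCochain (φ : augIdeal A B →ₗ[stdRes A B 0] W) : Cochain A B W 1 :=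
  diffCochain φ (face A B 0 0) (face A B 0 1) (aug_face 0 0) (aug_face 0 1)

theorem formCochain_apply (φ : augIdeal A B →ₗ[stdRes A B 0] W) (q : stdRes A B 1) :
    formCochain φ q =
      φ ⟨face A B 0 0 q - face A B 0 1 q, aug_face_sub_face q⟩ :=
  rfl

/-- The six double faces cancel in pairs by the simplicial identities. -/
theorem formCochain_mem_cocycles (φ : augIdeal A B →ₗ[stdRes A B 0] W) :
    formCochain φ ∈ cocycles A B W 1 := by
  refine Derivation.ext fun q => ?_
  rw [delta_one_apply]
  simp only [formCochain_apply]
  rw [← map_sub, ← map_add]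
  refine (congrArg φ (Subtype.ext ?_)).trans (map_zero φ)
  have h1 : face A B 0 0 (face A B 1 1 q) = face A B 0 0 (face A B 1 0 q) :=
    face_zero_face_succ 0 0 q
  have h2 : face A B 0 0 (face A B 1 2 q) = face A B 0 1 (face A B 1 0 q) :=
    face_zero_face_succ 0 1 q
  have h3 := face_one_face_one q
  simp only [Submodule.coe_add, AddSubgroupClass.coe_sub, Submodule.coe_zero]
  rw [h1, h2, h3]
  ring

theorem cocycleForm_formCochain (φ : augIdeal A B →ₗ[stdRes A B 0] W) (p : augIdeal A B) :
    cocycleForm (formCochain φ) p = φ p := by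
  rw [cocycleForm, formCochain_apply, formCochain_apply, ← map_sub]
  refine congrArg φ (Subtype.ext ?_)
  have hp : aug A B 0 p = 0 := p.2
  simp [hp]

end FirstCohomology

end AndreQuillen

/-! ### Polynomials vanishing at a fraction, and their derivatives -/

open Polynomial in
/-- Over an integrally closed domain, the polynomials vanishing at the fraction `a / b` are
generated by the linear ones. -/
theorem Polynomial.mem_span_linear_of_aeval_eq_zero {A : Type u} [CommRing A] [IsDomain A]
    [IsIntegrallyClosed A] {K : Type v} [Field K] [Algebra A K] [IsFractionRing A K] {a b : A}
    {x : K} (hx : x * algebraMap A K b = algebraMap A K a) {r : A[X]} (hr : aeval x r = 0) :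
    r ∈ Ideal.span {p : A[X] | ∃ l d : A, l * a = d * b ∧ p = C l * X - C d} := by
  induction hn : r.natDegree using Nat.strong_induction_on generalizing r with
  | _ n ih =>
    obtain _ | n := n
    · rw [eq_C_of_natDegree_eq_zero hn, aeval_C,
        FaithfulSMul.algebraMap_eq_zero_iff] at hr
      rw [eq_C_of_natDegree_eq_zero hn, hr, C_0]
      exact zero_mem _
    -- The leading coefficient times `x` is integral over `A`, hence equals some `d` in `A`;
    -- subtracting `X ^ n (lX - d)` then lowers the degree.
    · obtain ⟨d, hd⟩ := IsIntegrallyClosed.isIntegral_iff.mp (isIntegral_leadingCoeff_smul r x hr)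
      rw [Algebra.smul_def] at hd
      set l := r.leadingCoeff with hl
      have hld : l * a = d * b := by
        apply FaithfulSMul.algebraMap_injective A K
        rw [map_mul, map_mul, hd, ← hx]
        ring
      have hmem : X ^ n * (C l * X - C d) ∈
          Ideal.span {p : A[X] | ∃ l d : A, l * a = d * b ∧ p = C l * X - C d} :=
        Ideal.mul_mem_left _ _ (Ideal.subset_span ⟨l, d, hld, rfl⟩)
      have hdeg : (r - X ^ n * (C l * X - C d)).natDegree ≤ n := by
        rw [natDegree_le_iff_coeff_eq_zero]
        intro m hm
        have e : X ^ n * (C l * X - C d) = C l * X ^ (n + 1) - C d * X ^ n := by ring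
        rw [e, coeff_sub, coeff_sub, coeff_C_mul_X_pow, coeff_C_mul_X_pow, if_neg hm.ne']
        split_ifs with h
        · rw [h, hl, leadingCoeff, hn]
          ring
        · rw [coeff_eq_zero_of_natDegree_lt (by omega)]
          ring
      have h := ih _ (Nat.lt_succ_of_le hdeg) (r := r - X ^ n * (C l * X - C d))
        (by simp [hr, hd]) rfl
      simpa using add_mem h hmem

theorem mem_idealInverse_map_iff {A : Type u} [CommRing A] {K : Type v} [Field K] [Algebra A K]
    {B : Subalgebra A K} {I : Ideal A} {y : K} :
    y ∈ idealInverse K (I.map (algebraMap A B)) ↔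
      ∀ l ∈ I, ∃ c : B, (c : K) = y * algebraMap A K l := by
  refine ⟨fun h l hl => Submodule.mem_one.mp (h _ (Ideal.mem_map_of_mem _ hl)), fun h j hj => ?_⟩
  refine Submodule.span_induction ?_ ?_ ?_ ?_ hj
  · rintro _ ⟨l, hl, rfl⟩
    exact Submodule.mem_one.mpr (h l hl)
  · simp
  · intro p q _ _ hp hq
    rw [map_add, mul_add]
    exact add_mem hp hq
  · intro c p _ hp
    rw [smul_eq_mul, map_mul, mul_left_comm, ← Algebra.smul_def]
    exact Submodule.smul_mem _ c hp

open Polynomial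

/-- A surjection `M → N` induces an isomorphism `M / T⁻¹ Q ≃ N / Q`. -/
theorem Submodule.nonempty_quotientEquiv_of_surjective {R M N : Type*} [Ring R]
    [AddCommGroup M] [Module R M] [AddCommGroup N] [Module R N] {P : Submodule R M}
    {Q : Submodule R N} (T : M →ₗ[R] N) (hT : Function.Surjective T)
    (hPQ : ∀ m, T m ∈ Q ↔ m ∈ P) : Nonempty ((M ⧸ P) ≃ₗ[R] (N ⧸ Q)) := by
  have hker : P = LinearMap.ker (Q.mkQ ∘ₗ T) := by
    ext m
    rw [LinearMap.ker_comp, Submodule.ker_mkQ, Submodule.mem_comap, hPQ]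
  exact ⟨(Submodule.quotEquivOfEq _ _ hker).trans
    (LinearMap.quotKerEquivOfSurjective _ (Q.mkQ_surjective.comp hT))⟩

theorem Polynomial.exists_C_mul_eq_mul_linear {A : Type u} [CommRing A] {a b : A} {r : A[X]}
    (hr : r ∈ Ideal.span {p : A[X] | ∃ l d : A, l * a = d * b ∧ p = C l * X - C d}) :
    ∃ h : A[X], C b * r = h * (C b * X - C a) := by
  refine Submodule.span_induction ?_ ⟨0, by simp⟩ ?_ ?_ hr
  · rintro _ ⟨l, d, h, rfl⟩
    have h' : C l * C a = C d * C b := by rw [← C_mul, ← C_mul, h]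
    exact ⟨C l, by linear_combination h'⟩
  · rintro p q _ _ ⟨f, hf⟩ ⟨g, hg⟩
    exact ⟨f + g, by linear_combination hf + hg⟩
  · rintro c p _ ⟨f, hf⟩
    exact ⟨c * f, by rw [smul_eq_mul]; linear_combination c * hf⟩

theorem Polynomial.aeval_derivative_mem_map_colon {A : Type u} [CommRing A] {B : Type v}
    [CommRing B] [IsDomain B] [Algebra A B] [FaithfulSMul A B] {a b : A} (hb : b ≠ 0) {ξ : B}
    (hξ : ξ * algebraMap A B b = algebraMap A B a) {r : A[X]}
    (hr : r ∈ Ideal.span {p : A[X] | ∃ l d : A, l * a = d * b ∧ p = C l * X - C d}) :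
    aeval ξ (derivative r) ∈ ((Ideal.span {b}).colon {a}).map (algebraMap A B) := by
  -- Vanishing at `ξ` is carried along the induction to kill the term of the Leibniz rule that
  -- differentiates the coefficient.
  suffices h : aeval ξ r = 0 ∧
      aeval ξ (derivative r) ∈ ((Ideal.span {b}).colon {a}).map (algebraMap A B) from h.2
  refine Submodule.span_induction ?_ (by simp) ?_ ?_ hr
  · rintro _ ⟨l, d, h, rfl⟩
    constructor
    · have hb' : algebraMap A B b ≠ 0 := by
        rwa [Ne, FaithfulSMul.algebraMap_eq_zero_iff]
      apply mul_right_cancel₀ hb'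
      have h' := congrArg (algebraMap A B) h
      rw [map_mul, map_mul] at h'
      simp only [map_sub, map_mul, aeval_C, aeval_X]
      linear_combination algebraMap A B l * hξ + h'
    · have hl : l ∈ (Ideal.span {b}).colon {a} := by
        rw [Submodule.mem_colon_singleton, smul_eq_mul, h]
        exact Ideal.mul_mem_left _ _ (Ideal.mem_span_singleton_self b)
      simpa using Ideal.mem_map_of_mem (algebraMap A B) hl
  · rintro p q _ _ ⟨hp, hp'⟩ ⟨hq, hq'⟩
    rw [map_add, map_add, map_add, hp, hq, add_zero]
    exact ⟨rfl, add_mem hp' hq'⟩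
  · rintro c p _ ⟨hp, hp'⟩
    rw [smul_eq_mul, derivative_mul, map_add, map_mul, map_mul, map_mul, hp, mul_zero, mul_zero,
      zero_add]
    exact ⟨rfl, Ideal.mul_mem_left _ _ hp'⟩

/-! ### Comparison of `A[B]` with `A[X]` -/

namespace AndreQuillen

section Polynomial

variable {A : Type u} [CommRing A] {B : Type v} [CommRing B] [Algebra A B]

variable (A) in
/-- The homomorphism `A[X] → A[B]` which sends `X` to the variable indexed by `ξ`. -/
noncomputable def polyInc (ξ : B) : A[X] →ₐ[A] stdRes A B 0 := aeval (gen A B ξ)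

theorem aug_polyInc (ξ : B) (r : A[X]) : aug A B 0 (polyInc A ξ r) = aeval ξ r := by
  rw [polyInc, ← aeval_algHom_apply, aug_gen]

/-- The homomorphism `A[B] → A[X]` with prescribed values on the variables. -/
noncomputable def polyLift (ρ : B → A[X]) : stdRes A B 0 →ₐ[A] A[X] :=
  (MvPolynomial.aeval ρ : MvPolynomial B A →ₐ[A] A[X])

omit [CommRing B] [Algebra A B] in
theorem polyLift_gen (ρ : B → A[X]) (c : B) : polyLift ρ (gen A B c) = ρ c :=
  MvPolynomial.aeval_X _ _

theorem aeval_polyLift {ρ : B → A[X]} {ξ : B} (hρ : ∀ c, aeval ξ (ρ c) = c)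
    (p : stdRes A B 0) : aeval ξ (polyLift ρ p) = aug A B 0 p := by
  have h : (aeval ξ).comp (polyLift ρ) = aug A B 0 := by
    refine MvPolynomial.algHom_ext fun c => ?_
    change aeval ξ (polyLift ρ (gen A B c)) = aug A B 0 (gen A B c)
    rw [polyLift_gen, aug_gen, hρ]
  exact DFunLike.congr_fun h p

omit [CommRing B] [Algebra A B] in
theorem polyLift_polyInc {ρ : B → A[X]} {ξ : B} (hρ : ρ ξ = X) (r : A[X]) :
    polyLift ρ (polyInc A ξ r) = r := by
  rw [polyInc, ← aeval_algHom_apply, polyLift_gen, hρ, aeval_X_left_apply]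

/-- The derivation of `A[B]` induced by the derivation `d / dX` of `A[X]`. -/
noncomputable def polyDer {ρ : B → A[X]} {ξ : B} (hρ : ∀ c, aeval ξ (ρ c) = c) :
    Cochain A B B 0 :=
  Derivation.mk' ((aeval ξ).toLinearMap ∘ₗ derivative ∘ₗ (polyLift ρ).toLinearMap) fun p q => by
    simp [stdRes_smul_def, ← aeval_polyLift hρ, derivative_mul]
    ring

theorem polyDer_apply {ρ : B → A[X]} {ξ : B} (hρ : ∀ c, aeval ξ (ρ c) = c)
    (p : stdRes A B 0) : polyDer hρ p = aeval ξ (derivative (polyLift ρ p)) :=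
  rfl

theorem aeval_linear {a b : A} {ξ : B} (hξ : ξ * algebraMap A B b = algebraMap A B a) :
    aeval ξ (C b * X - C a) = 0 := by
  rw [map_sub, map_mul, aeval_C, aeval_X, aeval_C, mul_comm, hξ, sub_self]

/-- A linear form on the augmentation ideal of `A[B]` is determined on the image of `A[X]` by
its value at `bX - a`. -/
theorem mul_cocycleForm_polyInc [IsDomain B] {a b : A} {ξ : B}
    (hξ : ξ * algebraMap A B b = algebraMap A B a) (hb : algebraMap A B b ≠ 0)
    {D : Cochain A B B 1} (hD : D ∈ cocycles A B B 1) {r : A[X]} (hr : aeval ξ r = 0)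
    (hr' : r ∈ Ideal.span {p : A[X] | ∃ l d : A, l * a = d * b ∧ p = C l * X - C d}) :
    algebraMap A B b * cocycleForm D (polyInc A ξ r) =
      cocycleForm D (polyInc A ξ (C b * X - C a)) * aeval ξ (derivative r) := by
  -- Applying both the form and the derivative at `ξ` to `b r = h (bX - a)` gives two equations,
  -- from which `h(ξ)` is eliminated.
  obtain ⟨h, hh⟩ := exists_C_mul_eq_mul_linear hr'
  have h1 := congrArg (fun p => cocycleForm D (polyInc A ξ p)) hh
  have hlin := aeval_linear hξ
  simp only [map_mul (polyInc A ξ)] at h1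
  rw [cocycleForm_mul hD _ (by rw [aug_polyInc, hr]),
    cocycleForm_mul hD _ (by rw [aug_polyInc, hlin]), aug_polyInc, aug_polyInc, aeval_C,
    smul_eq_mul, smul_eq_mul] at h1
  have h2 := congrArg (fun p => aeval ξ (derivative p)) hh
  simp only [derivative_mul, derivative_C, zero_mul, zero_add, map_add, map_mul, hlin, mul_zero,
    aeval_C] at h2
  have h3 : aeval ξ (derivative (C b * X - C a)) = algebraMap A B b := by simp
  rw [h3] at h2
  apply mul_left_cancel₀ hb
  linear_combination algebraMap A B b * h1 - cocycleForm D (polyInc A ξ (C b * X - C a)) * h2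

end Polynomial

/-! ### The multiplier of a cocycle in `J⁻¹` -/

section Fraction

variable {A : Type u} [CommRing A] [IsDomain A] [IsIntegrallyClosed A]
  {K : Type v} [Field K] [Algebra A K] [IsFractionRing A K] {B : Subalgebra A K}

theorem mem_span_linear {a b : A} {ξ : B} (hξ : ξ * algebraMap A B b = algebraMap A B a)
    {r : A[X]} (hr : aeval ξ r = 0) :
    r ∈ Ideal.span {p : A[X] | ∃ l d : A, l * a = d * b ∧ p = C l * X - C d} := by
  refine mem_span_linear_of_aeval_eq_zero (K := K) (x := (ξ : K)) (congrArg Subtype.val hξ) ?_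
  have h := congrArg Subtype.val hr
  rwa [← Subalgebra.coe_val, ← aeval_algHom_apply, Subalgebra.coe_val] at h

/-- The map which sends a `1`-cocycle to the value of its linear form at `bX - a`, divided
by `b`. -/
noncomputable def cocycleMultiplier {a b : A} (hb : b ≠ 0) {ξ : B}
    (hξ : ξ * algebraMap A B b = algebraMap A B a) :
    cocycles A B B 1 →ₗ[B]
      idealInverse K (((Ideal.span {b}).colon {a}).map (algebraMap A B)) where
  toFun D := ⟨(cocycleForm D.1 (polyInc A ξ (C b * X - C a)) : B) / algebraMap A K b, by
    have hbK : algebraMap A K b ≠ 0 := by rwa [Ne, FaithfulSMul.algebraMap_eq_zero_iff]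
    rw [mem_idealInverse_map_iff]
    intro l hl
    rw [Submodule.mem_colon_singleton, smul_eq_mul, Ideal.mem_span_singleton'] at hl
    obtain ⟨d, hd⟩ := hl
    have hmem : C l * X - C d ∈
        Ideal.span {p : A[X] | ∃ l d : A, l * a = d * b ∧ p = C l * X - C d} :=
      Ideal.subset_span ⟨l, d, hd.symm, rfl⟩
    have hbB : algebraMap A B b ≠ 0 := by rwa [Ne, FaithfulSMul.algebraMap_eq_zero_iff]
    have hr : aeval ξ (C l * X - C d) = 0 := by
      apply mul_right_cancel₀ hbB
      have h' := congrArg (algebraMap A B) hd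
      rw [map_mul, map_mul] at h'
      simp only [map_sub, map_mul, aeval_C, aeval_X]
      linear_combination algebraMap A B l * hξ - h'
    have h := congrArg Subtype.val (mul_cocycleForm_polyInc hξ hbB D.2 hr hmem)
    -- Since `lX - d` has derivative `l`, its value under the form is the multiplier times `l`.
    refine ⟨cocycleForm D.1 (polyInc A ξ (C l * X - C d)), ?_⟩
    rw [div_mul_eq_mul_div, eq_div_iff hbK, mul_comm]
    simpa using h⟩
  map_add' D E := by
    refine Subtype.ext ?_
    simp only [cocycleForm, Submodule.coe_add, Derivation.add_apply]
    push_cast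
    ring
  map_smul' c D := by
    refine Subtype.ext ?_
    simp only [cocycleForm, Submodule.coe_smul, Derivation.smul_apply, RingHom.id_apply,
      Algebra.smul_def]
    push_cast
    simp
    ring

omit [IsIntegrallyClosed A] in
theorem coe_cocycleMultiplier {a b : A} (hb : b ≠ 0) {ξ : B}
    (hξ : ξ * algebraMap A B b = algebraMap A B a) (D : cocycles A B B 1) :
    (cocycleMultiplier hb hξ D : K) =
      (cocycleForm D.1 (polyInc A ξ (C b * X - C a)) : B) / algebraMap A K b :=
  rfl

theorem cocycleMultiplier_surjective {a b : A} (hb : b ≠ 0) {ξ : B}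
    (hξ : ξ * algebraMap A B b = algebraMap A B a) {ρ : B → A[X]}
    (hρ : ∀ c, aeval ξ (ρ c) = c) (hρξ : ρ ξ = X) :
    Function.Surjective (cocycleMultiplier hb hξ) := by
  rintro ⟨y, hy⟩
  have hbK : algebraMap A K b ≠ 0 := by rwa [Ne, FaithfulSMul.algebraMap_eq_zero_iff]
  -- Multiplication by `y` keeps the derivative of `p` in `B`, as that derivative lies in `J`; the
  -- products form the required linear form.
  have hex (p : augIdeal A B) : ∃ c : B, (c : K) = y * (polyDer hρ p : B) := by
    refine Submodule.mem_one.mp (hy _ ?_)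
    rw [polyDer_apply]
    refine aeval_derivative_mem_map_colon hb hξ (mem_span_linear hξ ?_)
    rw [aeval_polyLift hρ]
    exact p.2
  choose φ hφ using hex
  have hadd (p q : augIdeal A B) : φ (p + q) = φ p + φ q := by
    apply Subtype.ext
    push_cast
    rw [hφ, hφ, hφ, Submodule.coe_add, map_add]
    push_cast
    ring
  have hsmul (r : stdRes A B 0) (p : augIdeal A B) : φ (r • p) = aug A B 0 r • φ p := by
    have hp : aug A B 0 p = 0 := p.2
    have h : polyDer hρ (r • p : augIdeal A B) = aug A B 0 r * polyDer hρ p := by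
      change polyDer hρ (r * p) = _
      rw [Derivation.leibniz, stdRes_smul_def, stdRes_smul_def, hp, zero_smul, add_zero,
        smul_eq_mul]
    apply Subtype.ext
    rw [smul_eq_mul, hφ, h, MulMemClass.coe_mul, MulMemClass.coe_mul, hφ, mul_left_comm]
  let Φ : augIdeal A B →ₗ[stdRes A B 0] B :=
    { toFun := φ
      map_add' := hadd
      map_smul' := hsmul }
  refine ⟨⟨formCochain Φ, formCochain_mem_cocycles Φ⟩, Subtype.ext ?_⟩
  rw [coe_cocycleMultiplier]
  have hlin : aug A B 0 (polyInc A ξ (C b * X - C a)) = 0 := by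
    rw [aug_polyInc, aeval_linear hξ]
  rw [cocycleForm_formCochain Φ ⟨_, hlin⟩]
  change (φ _ : K) / _ = y
  rw [hφ, polyDer_apply, polyLift_polyInc hρξ]
  simp [hbK]

theorem cocycleMultiplier_mem_iff {a b : A} (hb : b ≠ 0) {ξ : B}
    (hξ : ξ * algebraMap A B b = algebraMap A B a) {ρ : B → A[X]}
    (hρ : ∀ c, aeval ξ (ρ c) = c) (D : cocycles A B B 1) :
    (cocycleMultiplier hb hξ D : K) ∈ (1 : Submodule B K) ↔
      (D : Cochain A B B 1) ∈ coboundaries A B B 1 := by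
  have hbK : algebraMap A K b ≠ 0 := by rwa [Ne, FaithfulSMul.algebraMap_eq_zero_iff]
  have hbB : algebraMap A B b ≠ 0 := by rwa [Ne, FaithfulSMul.algebraMap_eq_zero_iff]
  have hlin : aug A B 0 (polyInc A ξ (C b * X - C a)) = 0 := by
    rw [aug_polyInc, aeval_linear hξ]
  rw [coe_cocycleMultiplier, Submodule.mem_one]
  constructor
  · rintro ⟨w, hw⟩
    have hw' : cocycleForm D.1 (polyInc A ξ (C b * X - C a)) = w * algebraMap A B b := by
      rw [eq_div_iff hbK] at hw
      exact Subtype.ext hw.symm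
    have hσ (p : stdRes A B 0) : aug A B 0 (polyInc A ξ (polyLift ρ p)) = aug A B 0 p := by
      rw [aug_polyInc, aeval_polyLift hρ]
    -- With `σ` the projection of `A[B]` through `A[X]`, the form splits on `I` as `φ(p - σp) +
    -- φ(σp)`. The first term is a derivation on all of `A[B]`, and the second is `w` times the
    -- derivative.
    refine ⟨diffCochain (cocycleLinearForm D.2) (AlgHom.id A _)
      ((polyInc A ξ).comp (polyLift ρ)) (fun _ => rfl) hσ + w • polyDer hρ,
      delta_eq_of_cocycleForm D.2 _ fun p hp => ?_⟩
    have hr : aeval ξ (polyLift ρ p) = 0 := by rw [aeval_polyLift hρ, hp]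
    have h1 := mul_cocycleForm_polyInc hξ hbB D.2 hr (mem_span_linear hξ hr)
    have h2 : cocycleForm D.1 (polyInc A ξ (polyLift ρ p)) = w * polyDer hρ p := by
      apply mul_left_cancel₀ hbB
      rw [h1, hw', polyDer_apply]
      ring
    change cocycleForm D.1 (p - polyInc A ξ (polyLift ρ p)) + w • polyDer hρ p = _
    rw [smul_eq_mul, ← h2, ← cocycleForm_add D.2 (by rw [map_sub, hσ, sub_self])
      (by rw [hσ, hp]), sub_add_cancel]
  · rintro ⟨g, hg⟩
    -- A derivation over `A` sends `bX - a` to `b` times its value at the variable of `ξ`.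
    refine ⟨g (gen A B ξ), ?_⟩
    rw [← hg, cocycleForm_delta g hlin, eq_div_iff hbK]
    have e : polyInc A ξ (C b * X - C a) = b • gen A B ξ - algebraMap A _ a := by
      simp [polyInc, Algebra.smul_def]
    rw [e, map_sub, Derivation.map_smul, Derivation.map_algebraMap, sub_zero, Algebra.smul_def,
      mul_comm]
    rfl

end Fraction

end AndreQuillen

theorem theorem30 {A : Type u} [CommRing A] [IsDomain A] [IsIntegrallyClosed A]
    {K : Type v} [Field K] [Algebra A K] [IsFractionRing A K]
    (a b : A) (ha : a ≠ 0) (hb : b ≠ 0)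
    (B : Subalgebra A K) (hB : B = Algebra.adjoin A {algebraMap A K a / algebraMap A K b})
    (hab : Ideal.span {a ^ 2} ⊓ Ideal.span {b ^ 2} = (Ideal.span {a} ⊓ Ideal.span {b}) ^ 2) :
    Nonempty (AndreQuillen.H A B B 1 ≃ₗ[B]
      InverseQuotient K
        (Ideal.map (algebraMap A B) ((Ideal.span {b}).colon {a}))) := by
  classical
  have hbK : algebraMap A K b ≠ 0 := by rwa [Ne, FaithfulSMul.algebraMap_eq_zero_iff]
  let ξ : B := ⟨algebraMap A K a / algebraMap A K b, hB ▸ Algebra.self_mem_adjoin_singleton A _⟩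
  have hξ : ξ * algebraMap A B b = algebraMap A B a := Subtype.ext (div_mul_cancel₀ _ hbK)
  have hex (c : B) : ∃ r : A[X], aeval ξ r = c := by
    obtain ⟨c, hc⟩ := c
    have hc' := hc
    rw [hB, Algebra.adjoin_singleton_eq_range_aeval] at hc'
    obtain ⟨r, hr⟩ := hc'
    refine ⟨r, Subtype.ext ?_⟩
    rw [← Subalgebra.coe_val, ← aeval_algHom_apply]
    exact hr
  choose ρ₀ hρ₀ using hex
  -- Lifting `ξ` to `X` itself makes `polyLift ρ` a retraction of `polyInc`.
  let ρ : B → A[X] := Function.update ρ₀ ξ X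
  have hρξ : ρ ξ = X := Function.update_self ..
  have hρ (c : B) : aeval ξ (ρ c) = c := by
    by_cases h : c = ξ
    · rw [h, hρξ, aeval_X]
    · rw [show ρ c = ρ₀ c from Function.update_of_ne h .., hρ₀]
  exact Submodule.nonempty_quotientEquiv_of_surjective
    (AndreQuillen.cocycleMultiplier hb hξ)
    (AndreQuillen.cocycleMultiplier_surjective hb hξ hρ hρξ)
    (AndreQuillen.cocycleMultiplier_mem_iff hb hξ hρ)
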